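/- Let $E$ be a Banach space over $\mathbb{K}=\mathbb{R}$ or $\mathbb{C}$ with a shrinking unconditional finite dimensional decomposition: finite dimensional subspaces $E_1,E_2,\dots$ such that every $x\in E$ has a unique expansion $x=\sum_{i\ge1}x_i$ with $x_i\in E_i$, this series always converges unconditionally, and the associated projections $\pi_m x=\sum_{i=1}^m x_i$ (with $\pi_0=0$) satisfy $\|\gamma\circ\pi_m-\gamma\|\to0$ for every $\gamma\in E^*$. Let $J=\{m_j\}_{j\ge1}$ be a strictly increasing sequence of positive integers, put $m_0=0$ and $\sigma_j=\pi_{m_j}-\pi_{m_{j-1}}$ for $j\ge1$. For $k\ge1$ let $\mathcal{P}({}^kE)$ be the space of continuous $k$-homogeneous polynomials $P:E\to\mathbb{K}$ with norm $\|P\|=\sup_{\|x\|\le1}|P(x)|$, let $$\mathcal{D}_J({}^kE)=\Big\{P\in\mathcal{P}({}^kE): P(x)=\sum_{j=1}^\infty P(\sigma_j(x))\ \text{for all } x\in E\Big\},$$ and let $\mathcal{D}_{J,w}({}^kE)$ be the subspace of those $P\in\mathcal{D}_J({}^kE)$ that are weakly continuous on bounded subsets of $E$. Let $n\ge1$ be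 an integer and suppose that for all $\varepsilon>0$ and all $j_0\in\mathbb{N}$ there exists $j>j_0$ such that for every $x\in E$, $$\|\pi_{m_j}x\|^n+\|x-\pi_{m_j}x\|^n\le(1+\varepsilon)\|x\|^n.$$ Then, for every integer $k\ge n$, $\mathcal{D}_{J,w}({}^kE)$ is an M-ideal in $X=\mathcal{D}_J({}^kE)$; that is, it is closed in $X$ and $X^*=\mathcal{D}_{J,w}({}^kE)^\perp\oplus_1 Z$ for some closed subspace $Z$ of $X^*$, where $\perp$ denotes the annihilator in $X^*$ and $\oplus_1$ means that $X^*$ is the direct sum of the two subspaces and $\|f+g\|=\|f\|+\|g\|$ for $f$ in the first and $g$ in the second. -/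

import Mathlib

open Filter Topology

noncomputable section

/-! ### Continuous homogeneous polynomials -/

section HomPoly

variable (𝕜 E : Type*) [RCLike 𝕜] [NormedAddCommGroup E] [NormedSpace 𝕜 E]

/-- The functions `x ↦ A (x, …, x)` with `A` a continuous `n`-linear form, as a vector space of
functions. -/
def homPolySubmodule (n : ℕ) : Submodule 𝕜 (E → 𝕜) where
  carrier := {P | ∃ A : ContinuousMultilinearMap 𝕜 (fun _ : Fin n => E) 𝕜,
    ∀ x, P x = A (fun _ => x)}
  add_mem' := by
    rintro P Q ⟨A, hA⟩ ⟨B, hB⟩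
    exact ⟨A + B, fun x => by simp [hA, hB]⟩
  zero_mem' := ⟨0, fun x => by simp⟩
  smul_mem' := by
    rintro c P ⟨A, hA⟩
    exact ⟨c • A, fun x => by simp [hA]⟩

/-- The space of continuous scalar-valued `n`-homogeneous polynomials on `E`. It is a type of its
own, so that it carries the norm below and not the topology of pointwise convergence. -/
def HomPoly (n : ℕ) : Type _ := homPolySubmodule 𝕜 E n

namespace HomPoly

variable {𝕜 E} {n : ℕ}

instance : AddCommGroup (HomPoly 𝕜 E n) := inferInstanceAs (AddCommGroup (homPolySubmodule 𝕜 E n))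

instance : Module 𝕜 (HomPoly 𝕜 E n) := inferInstanceAs (Module 𝕜 (homPolySubmodule 𝕜 E n))

instance : CoeFun (HomPoly 𝕜 E n) (fun _ => E → 𝕜) := ⟨fun P => P.1⟩

theorem ext {P Q : HomPoly 𝕜 E n} (h : ∀ x, P x = Q x) : P = Q := Subtype.ext (funext h)

@[simp] theorem zero_apply (x : E) : (0 : HomPoly 𝕜 E n) x = 0 := rfl

@[simp] theorem add_apply (P Q : HomPoly 𝕜 E n) (x : E) : (P + Q) x = P x + Q x := rfl

@[simp] theorem smul_apply (c : 𝕜) (P : HomPoly 𝕜 E n) (x : E) : (c • P) x = c * P x := rfl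

theorem map_smul (P : HomPoly 𝕜 E n) (c : 𝕜) (x : E) : P (c • x) = c ^ n * P x := by
  obtain ⟨A, hA⟩ := P.2
  rw [hA, hA]
  simpa using A.map_smul_univ (fun _ => c) (fun _ => x)

/-- `‖P‖ = sup {|P x| : ‖x‖ ≤ 1}`. -/
instance : Norm (HomPoly 𝕜 E n) := ⟨fun P => sSup ((fun x => ‖P x‖) '' {x : E | ‖x‖ ≤ 1})⟩

theorem norm_def (P : HomPoly 𝕜 E n) :
    ‖P‖ = sSup ((fun x => ‖P x‖) '' {x : E | ‖x‖ ≤ 1}) := rfl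

theorem bddAbove (P : HomPoly 𝕜 E n) :
    BddAbove ((fun x => ‖P x‖) '' {x : E | ‖x‖ ≤ 1}) := by
  obtain ⟨A, hA⟩ := P.2
  refine ⟨‖A‖, ?_⟩
  rintro _ ⟨x, hx, rfl⟩
  simp only [hA]
  refine (A.le_opNorm _).trans ?_
  have h : ∏ _i : Fin n, ‖x‖ ≤ 1 := by
    simpa using pow_le_one₀ (norm_nonneg x) hx
  simpa using mul_le_mul_of_nonneg_left h (norm_nonneg A)

theorem norm_apply_le (P : HomPoly 𝕜 E n) {x : E} (hx : ‖x‖ ≤ 1) : ‖P x‖ ≤ ‖P‖ :=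
  le_csSup P.bddAbove ⟨x, hx, rfl⟩

theorem norm_le (P : HomPoly 𝕜 E n) {C : ℝ} (h : ∀ x : E, ‖x‖ ≤ 1 → ‖P x‖ ≤ C) : ‖P‖ ≤ C := by
  refine csSup_le ⟨_, 0, by simp, rfl⟩ ?_
  rintro _ ⟨x, hx, rfl⟩
  exact h x hx

theorem norm_nonneg' (P : HomPoly 𝕜 E n) : 0 ≤ ‖P‖ :=
  (norm_nonneg (P 0)).trans (P.norm_apply_le (by simp))

theorem normedSpaceCore : NormedSpace.Core 𝕜 (HomPoly 𝕜 E n) where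
  norm_nonneg := norm_nonneg'
  norm_smul c P := by
    have key : ∀ (c : 𝕜) (P : HomPoly 𝕜 E n), ‖c • P‖ ≤ ‖c‖ * ‖P‖ := fun c P =>
      norm_le _ fun x hx => by
        rw [smul_apply, norm_mul]
        exact mul_le_mul_of_nonneg_left (P.norm_apply_le hx) (norm_nonneg c)
    refine le_antisymm (key c P) ?_
    by_cases hc : c = 0
    · subst hc
      simpa using norm_nonneg' _
    · have h := key c⁻¹ (c • P)
      rw [inv_smul_smul₀ hc, norm_inv] at h
      have hc' : 0 < ‖c‖ := norm_pos_iff.2 hc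
      calc ‖c‖ * ‖P‖ ≤ ‖c‖ * (‖c‖⁻¹ * ‖c • P‖) := mul_le_mul_of_nonneg_left h hc'.le
        _ = ‖c • P‖ := by field_simp
  norm_triangle P Q := norm_le _ fun x hx =>
    (norm_add_le (P x) (Q x)).trans (add_le_add (P.norm_apply_le hx) (Q.norm_apply_le hx))
  norm_eq_zero_iff P := by
    constructor
    · intro h
      have hball : ∀ x : E, ‖x‖ ≤ 1 → P x = 0 := fun x hx =>
        norm_le_zero_iff.1 ((P.norm_apply_le hx).trans h.le)
      refine ext fun x => ?_
      by_cases hx : ‖x‖ ≤ 1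
      · simpa using hball x hx
      · have hx0 : (‖x‖ : 𝕜) ≠ 0 := by
          simp only [ne_eq, RCLike.ofReal_eq_zero]
          intro h0
          exact hx (by simp [h0])
        have h1 : ‖((‖x‖ : 𝕜)⁻¹) • x‖ ≤ 1 := by
          rw [norm_smul, norm_inv, RCLike.norm_ofReal, abs_norm]
          exact inv_mul_le_one
        have h2 := P.map_smul (‖x‖ : 𝕜) (((‖x‖ : 𝕜)⁻¹) • x)
        rw [smul_inv_smul₀ hx0, hball _ h1] at h2
        simpa using h2
    · rintro rfl
      exact le_antisymm (norm_le _ fun x _ => by simp) (norm_nonneg' _)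

instance : NormedAddCommGroup (HomPoly 𝕜 E n) := NormedAddCommGroup.ofCore normedSpaceCore

instance : NormedSpace 𝕜 (HomPoly 𝕜 E n) := NormedSpace.ofCore normedSpaceCore

end HomPoly

/-- The subspace of those continuous `n`-homogeneous polynomials that are weakly continuous on
bounded sets: the restriction to each bounded subset of `E`, with the topology induced by the weak
topology of `E`, is continuous. -/
def weaklyContHomPoly (n : ℕ) : Submodule 𝕜 (HomPoly 𝕜 E n) where
  carrier := {P | ∀ B : Set E, Bornology.IsBounded B →
    ContinuousOn (fun y : WeakSpace 𝕜 E => P ((toWeakSpace 𝕜 E).symm y)) (toWeakSpace 𝕜 E '' B)}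
  add_mem' := fun hP hQ B hB => (hP B hB).add (hQ B hB)
  zero_mem' := fun _ _ => continuousOn_const
  smul_mem' := fun _ _ hP B hB => continuousOn_const.mul (hP B hB)

end HomPoly

/-! ### M-ideals -/

section MIdeal

variable {𝕜 X : Type*} [RCLike 𝕜] [NormedAddCommGroup X] [NormedSpace 𝕜 X]

/-- The annihilator of `J` in the dual of `X`. -/
def annihilator (J : Submodule 𝕜 X) : Submodule 𝕜 (StrongDual 𝕜 X) where
  carrier := {f | ∀ x ∈ J, f x = 0}
  add_mem' := fun hf hg x hx => by simp [hf x hx, hg x hx]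
  zero_mem' := fun _ _ => rfl
  smul_mem' := fun c _ hf x hx => by simp [hf x hx]

/-- `J` is an M-ideal in `X`: it is closed, and the dual of `X` is the `ℓ₁`-direct sum of the
annihilator of `J` and some closed subspace. -/
def IsMIdeal (J : Submodule 𝕜 X) : Prop :=
  IsClosed (J : Set X) ∧
    ∃ K : Submodule 𝕜 (StrongDual 𝕜 X), IsClosed (K : Set (StrongDual 𝕜 X)) ∧
      IsCompl (annihilator J) K ∧
      ∀ f ∈ annihilator J, ∀ g ∈ K, ‖f + g‖ = ‖f‖ + ‖g‖

end MIdeal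

/-! ### Finite dimensional decompositions -/

/-- A finite dimensional decomposition of `E`: finite dimensional subspaces such that every vector
has a unique expansion as the sum of a series with one term in each of them. -/
structure FDD (𝕜 E : Type*) [RCLike 𝕜] [NormedAddCommGroup E] [NormedSpace 𝕜 E] where
  summand : ℕ → Submodule 𝕜 E
  finiteDimensional : ∀ i, FiniteDimensional 𝕜 (summand i)
  existsUnique_expansion : ∀ x : E, ∃! a : ℕ → E, (∀ i, a i ∈ summand i) ∧
    Tendsto (fun N => ∑ i ∈ Finset.range N, a i) atTop (𝓝 x)

namespace FDD

variable {𝕜 E : Type*} [RCLike 𝕜] [NormedAddCommGroup E] [NormedSpace 𝕜 E] (D : FDD 𝕜 E)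

/-- The terms of the expansion of `x`. -/
def coeff (x : E) : ℕ → E := (D.existsUnique_expansion x).choose

theorem coeff_mem (x : E) (i : ℕ) : D.coeff x i ∈ D.summand i :=
  (D.existsUnique_expansion x).choose_spec.1.1 i

theorem tendsto_coeff (x : E) :
    Tendsto (fun N => ∑ i ∈ Finset.range N, D.coeff x i) atTop (𝓝 x) :=
  (D.existsUnique_expansion x).choose_spec.1.2

theorem eq_coeff {x : E} {a : ℕ → E} (ha : ∀ i, a i ∈ D.summand i)
    (h : Tendsto (fun N => ∑ i ∈ Finset.range N, a i) atTop (𝓝 x)) : a = D.coeff x :=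
  (D.existsUnique_expansion x).choose_spec.2 a ⟨ha, h⟩

theorem coeff_add (x y : E) : D.coeff (x + y) = D.coeff x + D.coeff y := by
  refine (D.eq_coeff (fun i => (D.summand i).add_mem (D.coeff_mem x i) (D.coeff_mem y i)) ?_).symm
  simpa [Finset.sum_add_distrib] using (D.tendsto_coeff x).add (D.tendsto_coeff y)

theorem coeff_smul (c : 𝕜) (x : E) : D.coeff (c • x) = c • D.coeff x := by
  refine (D.eq_coeff (fun i => (D.summand i).smul_mem c (D.coeff_mem x i)) ?_).symm
  simpa [Finset.smul_sum] using (D.tendsto_coeff x).const_smul c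

/-- The partial sum projection `x ↦ x_0 + ⋯ + x_{m-1}`, as a linear map. -/
def projLinear (m : ℕ) : E →ₗ[𝕜] E where
  toFun x := ∑ i ∈ Finset.range m, D.coeff x i
  map_add' x y := by simp [D.coeff_add, Finset.sum_add_distrib]
  map_smul' c x := by simp [D.coeff_smul, Finset.smul_sum]

theorem projLinear_bounded (x : E) : ∃ C, ∀ m, ‖D.projLinear m x‖ ≤ C := by
  obtain ⟨C, hC⟩ := (Metric.isBounded_range_of_tendsto _ (D.tendsto_coeff x)).exists_norm_le
  exact ⟨C, fun m => hC _ ⟨m, rfl⟩⟩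

/-- The bounded sequence of all partial sums of the expansion of `x`. -/
def partialSums : E →ₗ[𝕜] BoundedContinuousFunction ℕ E where
  toFun x := BoundedContinuousFunction.ofNormedAddCommGroupDiscrete (fun m => D.projLinear m x)
    (D.projLinear_bounded x).choose (D.projLinear_bounded x).choose_spec
  map_add' x y := by ext m; simp
  map_smul' c x := by ext m; simp

theorem partialSums_apply (x : E) (m : ℕ) : D.partialSums x m = D.projLinear m x := rfl

theorem continuous_partialSums [CompleteSpace E] : Continuous D.partialSums := by
  refine D.partialSums.continuous_of_seq_closed_graph fun u x s hu hs => ?_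
  have hpt : ∀ m, Tendsto (fun p => D.projLinear m (u p)) atTop (𝓝 (s m)) := fun m =>
    ((BoundedContinuousFunction.evalCLM 𝕜 m).continuous.tendsto s).comp hs
  have hmem : ∀ i, s (i + 1) - s i ∈ D.summand i := fun i => by
    have := D.finiteDimensional i
    refine (D.summand i).closed_of_finiteDimensional.mem_of_tendsto ((hpt (i + 1)).sub (hpt i))
      (Eventually.of_forall fun p => ?_)
    have h : D.projLinear (i + 1) (u p) - D.projLinear i (u p) = D.coeff (u p) i := by
      simp [projLinear, Finset.sum_range_succ]
    rw [h]
    exact D.coeff_mem _ i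
  have h0 : s 0 = 0 := tendsto_nhds_unique (hpt 0) (by simp [projLinear])
  have hsum : ∀ N, ∑ i ∈ Finset.range N, (s (i + 1) - s i) = s N := fun N => by
    rw [Finset.sum_range_sub, h0, sub_zero]
  have hlim : Tendsto (fun N => s N) atTop (𝓝 x) := by
    rw [Metric.tendsto_atTop]
    intro ε hε
    obtain ⟨p, hp1, hp2⟩ := (((Metric.tendsto_nhds.1 hu) (ε / 3) (by positivity)).and
      ((Metric.tendsto_nhds.1 hs) (ε / 3) (by positivity))).exists
    obtain ⟨N, hN⟩ := Metric.tendsto_atTop.1 (D.tendsto_coeff (u p)) (ε / 3) (by positivity)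
    refine ⟨N, fun q hq => ?_⟩
    have h1 : dist (s q) (D.projLinear q (u p)) < ε / 3 := by
      rw [dist_comm]
      exact (BoundedContinuousFunction.dist_coe_le_dist (f := D.partialSums (u p)) (g := s) q).trans_lt
        hp2
    have h2 : dist (D.projLinear q (u p)) (u p) < ε / 3 := hN q hq
    linarith [dist_triangle (s q) (D.projLinear q (u p)) x,
      dist_triangle (D.projLinear q (u p)) (u p) x]
  have hc := D.eq_coeff hmem (by simpa only [hsum] using hlim)
  ext N
  rw [partialSums_apply, ← hsum N, hc]
  rfl

theorem continuous_projLinear [CompleteSpace E] (m : ℕ) : Continuous (D.projLinear m) :=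
  (BoundedContinuousFunction.evalCLM 𝕜 m).continuous.comp D.continuous_partialSums

/-- The decomposition is unconditional: every expansion converges unconditionally. -/
def IsUnconditional : Prop := ∀ x : E, HasSum (D.coeff x) x

variable [CompleteSpace E]

/-- The projection `π_m` associated with the decomposition, onto the span of the first `m`
summands: `π_m x` is the sum of the first `m` terms of the expansion of `x`; so `π_0 = 0`. -/
def proj (m : ℕ) : E →L[𝕜] E := ⟨D.projLinear m, D.continuous_projLinear m⟩

theorem proj_apply (m : ℕ) (x : E) : D.proj m x = ∑ i ∈ Finset.range m, D.coeff x i := rfl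

/-- The decomposition is shrinking: the adjoints of `π_m` converge pointwise in norm to the identity
of the dual of `E`. -/
def IsShrinking : Prop :=
  ∀ γ : StrongDual 𝕜 E, Tendsto (fun m => γ.comp (D.proj m)) atTop (𝓝 γ)

/-- The block projection `π_{m_{j+1}} - π_{m_j}`, `j = 0, 1, 2, …`. -/
def blockProj (m : ℕ → ℕ) (j : ℕ) : E →L[𝕜] E := D.proj (m (j + 1)) - D.proj (m j)

/-- The space of block diagonal `k`-homogeneous polynomials with respect to `m`: the continuous
`k`-homogeneous polynomials `P` with `P x = ∑_j P (σ_j x)` (as a convergent series) for all `x`,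
where the `σ_j` are the block projections. -/
def blockDiagonal (m : ℕ → ℕ) (k : ℕ) : Submodule 𝕜 (HomPoly 𝕜 E k) where
  carrier := {P | ∀ x, Tendsto (fun N => ∑ j ∈ Finset.range N, P (D.blockProj m j x)) atTop
    (𝓝 (P x))}
  add_mem' := fun hP hQ x => by
    simpa [Finset.sum_add_distrib] using (hP x).add (hQ x)
  zero_mem' := fun x => by simp
  smul_mem' := fun c P hP x => by
    simpa [Finset.mul_sum] using (hP x).const_mul c

/-- The block diagonal polynomials that are weakly continuous on bounded sets, as a subspace of the
normed space of block diagonal polynomials. -/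
def blockDiagonalW (m : ℕ → ℕ) (k : ℕ) : Submodule 𝕜 (D.blockDiagonal m k) :=
  (weaklyContHomPoly 𝕜 E k).comap (D.blockDiagonal m k).subtype

end FDD

end

/-! ### A criterion for M-ideals -/

section MIdealCriterion

variable {𝕜 X : Type*} [RCLike 𝕜] [NormedAddCommGroup X] [NormedSpace 𝕜 X]

/-! Let `T_j P = P ∘ π_{m_j}`. Since `π_{m_j}` has finite rank, `T_j P` is weakly continuous on
bounded sets. Since `m_j` ends a block, block diagonality gives `P x = P (π_{m_j} x) + P (x -
π_{m_j} x)`, so `P - T_j P = P ∘ (1 - π_{m_j})` (`coe_sub_compProj`). This has two consequences. If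
`P` is weakly continuous on bounded sets, shrinkingness gives `T_j P → P` in norm
(`tendsto_compProj`). And `T_j P + (Q - T_j Q)` takes the value `P (π_{m_j} x) + Q (x - π_{m_j} x)`
at `x`, so the hypothesis on `n`-th powers, carried over to `k`-th powers, bounds its norm by nearly
`max ‖P‖ ‖Q‖` for suitable arbitrarily large `j` (`norm_compProj_add_le`). Such operators force an
M-ideal (`IsMIdeal.of_approximation`): a pointwise ultrafilter limit of their adjoints is a
projection of the dual whose kernel is the annihilator, and the norm bound dualizes to additivity of
norms. -/

theorem StrongDual.norm_le_of_forall_unit_ball {f : StrongDual 𝕜 X} {C : ℝ}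
    (h : ∀ x, ‖x‖ ≤ 1 → ‖f x‖ ≤ C) : ‖f‖ ≤ C := by
  have hC : 0 ≤ C := (norm_nonneg (f 0)).trans (h 0 (by simp))
  refine f.opNorm_le_bound hC fun x => ?_
  by_cases hx : x = 0
  · simp [hx]
  have hx' : 0 < ‖x‖ := norm_pos_iff.2 hx
  have h1 := h (((‖x‖ : 𝕜)⁻¹) • x) (by
    rw [norm_smul, norm_inv, RCLike.norm_ofReal, abs_norm]
    exact inv_mul_le_one)
  rw [_root_.map_smul, norm_smul, norm_inv, RCLike.norm_ofReal, abs_norm] at h1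
  rwa [inv_mul_le_iff₀ hx', mul_comm] at h1

/-- Unimodular factors on `x` and `y` align the phases of `g x` and `f y`; the two suprema are then
taken independently. -/
theorem norm_add_norm_le_of_forall_unit_ball {f g : StrongDual 𝕜 X} {M : ℝ}
    (h : ∀ x y, ‖x‖ ≤ 1 → ‖y‖ ≤ 1 → ‖g x + f y‖ ≤ M) : ‖f‖ + ‖g‖ ≤ M := by
  have key : ∀ x y, ‖x‖ ≤ 1 → ‖y‖ ≤ 1 → ‖g x‖ + ‖f y‖ ≤ M := fun x y hx hy => by
    obtain ⟨a, ha, hax⟩ := RCLike.exists_norm_eq_mul_self (g x)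
    obtain ⟨b, hb, hby⟩ := RCLike.exists_norm_eq_mul_self (f y)
    have h1 := h (a • x) (b • y) (by simpa [norm_smul, ha]) (by simpa [norm_smul, hb])
    rw [_root_.map_smul, _root_.map_smul, smul_eq_mul, smul_eq_mul, ← hax, ← hby,
      ← RCLike.ofReal_add, RCLike.norm_ofReal] at h1
    exact (le_abs_self _).trans h1
  have hf : ‖f‖ ≤ M - ‖g‖ := StrongDual.norm_le_of_forall_unit_ball fun y hy => by
    have hg : ‖g‖ ≤ M - ‖f y‖ := StrongDual.norm_le_of_forall_unit_ball fun x hx => by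
      linarith [key x y hx hy]
    linarith
  linarith

/-- The functionals that are recovered pointwise from their compositions with `T i` along `l`. -/
def recoveredFunctionals (T : ℕ → X →L[𝕜] X) (l : Filter ℕ) : Submodule 𝕜 (StrongDual 𝕜 X) where
  carrier := {f | ∀ x, Tendsto (fun i => f (T i x)) l (𝓝 (f x))}
  add_mem' := fun hf hg x => by simpa using (hf x).add (hg x)
  zero_mem' := fun x => by simpa using tendsto_const_nhds
  smul_mem' := fun c f hf x => by simpa using (hf x).const_mul c

/-- Bounded scalars converge along an ultrafilter by compactness, and uniqueness of limits makes the
pointwise limit linear. -/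
theorem exists_tendsto_ultrafilter (T : ℕ → X →L[𝕜] X) {C : ℝ} (hC : ∀ i x, ‖T i x‖ ≤ C * ‖x‖)
    (U : Ultrafilter ℕ) (f : StrongDual 𝕜 X) :
    ∃ g : StrongDual 𝕜 X, ∀ x, Tendsto (fun i => f (T i x)) U (𝓝 (g x)) := by
  have hb : ∀ x i, ‖f (T i x)‖ ≤ ‖f‖ * C * ‖x‖ := fun x i => by
    rw [mul_assoc]
    exact (f.le_opNorm _).trans (mul_le_mul_of_nonneg_left (hC i x) (norm_nonneg f))
  have hlim : ∀ x, ∃ a : 𝕜, ‖a‖ ≤ ‖f‖ * C * ‖x‖ ∧ Tendsto (fun i => f (T i x)) U (𝓝 a) := by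
    intro x
    obtain ⟨a, ha, hle⟩ := (isCompact_closedBall (0 : 𝕜) (‖f‖ * C * ‖x‖)).ultrafilter_le_nhds
      (U.map fun i => f (T i x)) (by
        rw [le_principal_iff]
        exact Filter.mem_map.2 (Filter.univ_mem' fun i => by simpa using hb x i))
    exact ⟨a, by simpa using ha, hle⟩
  choose g hg hgt using hlim
  let g' : X →ₗ[𝕜] 𝕜 :=
    { toFun := g
      map_add' := fun x y => tendsto_nhds_unique (hgt (x + y)) (by
        simpa using (hgt x).add (hgt y))
      map_smul' := fun c x => tendsto_nhds_unique (hgt (c • x)) (by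
        simpa using (hgt x).const_mul c) }
  exact ⟨g'.mkContinuous (‖f‖ * C) hg, hgt⟩

/-- A closed subspace `J` is an M-ideal as soon as there are operators `T i` into `J`, converging
pointwise to the identity on `J`, with `‖T i x + (y - T i y)‖ ≤ c i * max ‖x‖ ‖y‖` and `c i → 1`. -/
theorem IsMIdeal.of_approximation {J : Submodule 𝕜 X} (hJ : IsClosed (J : Set X))
    (T : ℕ → X →L[𝕜] X) (c : ℕ → ℝ) (hc : Tendsto c atTop (𝓝 1))
    (hTJ : ∀ i x, T i x ∈ J) (hlim : ∀ x ∈ J, Tendsto (fun i => T i x) atTop (𝓝 x))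
    (hT : ∀ i x y, ‖T i x + (y - T i y)‖ ≤ c i * max ‖x‖ ‖y‖) : IsMIdeal J := by
  obtain ⟨C, hC⟩ := hc.bddAbove_range
  have hbound : ∀ i x, ‖T i x‖ ≤ C * ‖x‖ := fun i x => by
    have h1 := hT i x 0
    simp only [map_zero, sub_zero, add_zero, norm_zero, max_eq_left (norm_nonneg x)] at h1
    exact h1.trans (mul_le_mul_of_nonneg_right (hC ⟨i, rfl⟩) (norm_nonneg x))
  let U : Ultrafilter ℕ := Ultrafilter.of atTop
  have hU : (U : Filter ℕ) ≤ atTop := Ultrafilter.of_le atTop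
  let K := recoveredFunctionals T (U : Filter ℕ)
  have hnorm : ∀ f ∈ annihilator J, ∀ g ∈ K, ‖f + g‖ = ‖f‖ + ‖g‖ := by
    intro f hf g hg
    refine le_antisymm (norm_add_le f g) (norm_add_norm_le_of_forall_unit_ball fun x y hx hy => ?_)
    -- `f` vanishes on the range of `T i`, leaving `g (T i x) + f y + (g y - g (T i y))`, whose last
    -- bracket tends to zero.
    have hleft : Tendsto (fun i => ‖(f + g) (T i x + (y - T i y))‖) U (𝓝 ‖g x + f y‖) := by
      have h1 := ((hg x).add ((tendsto_const_nhds (x := f y + g y)).sub (hg y))).norm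
      rw [add_sub_cancel_right] at h1
      refine h1.congr fun i => ?_
      simp only [_root_.map_add, _root_.map_sub, _root_.add_apply,
        hf _ (hTJ i x), hf _ (hTJ i y)]
      congr 1
      ring
    have hright : Tendsto (fun i => ‖f + g‖ * |c i|) U (𝓝 ‖f + g‖) := by
      simpa using (hc.mono_left hU).abs.const_mul ‖f + g‖
    refine le_of_tendsto_of_tendsto' hleft hright fun i => ((f + g).le_opNorm _).trans ?_
    refine mul_le_mul_of_nonneg_left ((hT i x y).trans ?_) (norm_nonneg _)
    have hm : max ‖x‖ ‖y‖ ≤ 1 := max_le hx hy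
    have hm0 : 0 ≤ max ‖x‖ ‖y‖ := le_max_of_le_left (norm_nonneg x)
    calc c i * max ‖x‖ ‖y‖ ≤ |c i| * max ‖x‖ ‖y‖ :=
          mul_le_mul_of_nonneg_right (le_abs_self _) hm0
      _ ≤ |c i| := mul_le_of_le_one_right (abs_nonneg _) hm
  have hdecomp : ∀ f : StrongDual 𝕜 X, ∃ a ∈ annihilator J, ∃ b ∈ K, a + b = f := by
    intro f
    obtain ⟨g, hg⟩ := exists_tendsto_ultrafilter T hbound U f
    have hgf : ∀ x ∈ J, g x = f x := fun x hx =>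
      tendsto_nhds_unique (hg x) (((f.continuous.tendsto x).comp (hlim x hx)).mono_left hU)
    refine ⟨f - g, fun x hx => by simp [hgf x hx], g, fun x => ?_, sub_add_cancel f g⟩
    -- `g` and `f` agree on `J`, hence on every `T i x`; so the limit defining `g` also recovers `g`
    -- from itself.
    exact (hg x).congr fun i => (hgf _ (hTJ i x)).symm
  refine ⟨hJ, K, ?_, ⟨?_, ?_⟩, hnorm⟩
  · refine isClosed_of_closure_subset fun f hf => ?_
    obtain ⟨a, ha, b, hb, rfl⟩ := hdecomp f
    -- By additivity of norms, the distance from `a + b` to any element of `K` is at least `‖a‖`.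
    have ha0 : a = 0 := by
      refine norm_le_zero_iff.1 (le_of_forall_pos_le_add fun ε hε => ?_)
      obtain ⟨g, hg, hfg⟩ := Metric.mem_closure_iff.1 hf ε hε
      rw [dist_eq_norm, add_sub_assoc, hnorm a ha _ (K.sub_mem hb hg)] at hfg
      linarith [norm_nonneg (b - g)]
    simpa [ha0] using hb
  · rw [Submodule.disjoint_def]
    intro f hf hfK
    ext x
    refine tendsto_nhds_unique (hfK x) ?_
    simp [hf _ (hTJ _ x)]
  · rw [codisjoint_iff, eq_top_iff]
    intro f _
    obtain ⟨a, ha, b, hb, rfl⟩ := hdecomp f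
    exact Submodule.add_mem_sup ha hb

end MIdealCriterion

/-! ### Homogeneous polynomials -/

namespace HomPoly

variable {𝕜 E : Type*} [RCLike 𝕜] [NormedAddCommGroup E] [NormedSpace 𝕜 E] {n : ℕ}

protected theorem continuous (P : HomPoly 𝕜 E n) : Continuous P := by
  obtain ⟨A, hA⟩ := P.2
  have : (P : E → 𝕜) = fun x => A (fun _ => x) := funext hA
  rw [this]
  exact A.cont.comp (by fun_prop)

theorem map_zero (P : HomPoly 𝕜 E n) (hn : n ≠ 0) : P 0 = 0 := by
  simpa [hn] using P.map_smul 0 0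

theorem norm_apply_le_mul_pow (P : HomPoly 𝕜 E n) (x : E) : ‖P x‖ ≤ ‖P‖ * ‖x‖ ^ n := by
  by_cases hx : x = 0
  · subst hx
    rcases Nat.eq_zero_or_pos n with rfl | hn
    · simpa using P.norm_apply_le (x := 0) (by simp)
    · simp [P.map_zero hn.ne', hn.ne']
  have hx0 : (‖x‖ : 𝕜) ≠ 0 := by simpa using hx
  have h1 : ‖((‖x‖ : 𝕜)⁻¹) • x‖ ≤ 1 := by
    rw [norm_smul, norm_inv, RCLike.norm_ofReal, abs_norm]
    exact inv_mul_le_one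
  have h2 := P.map_smul (‖x‖ : 𝕜) (((‖x‖ : 𝕜)⁻¹) • x)
  rw [smul_inv_smul₀ hx0] at h2
  rw [h2, norm_mul, norm_pow, RCLike.norm_ofReal, abs_norm, mul_comm]
  exact mul_le_mul_of_nonneg_right (P.norm_apply_le h1) (by positivity)

/-- Composition of a homogeneous polynomial with a continuous linear map. -/
def comp (P : HomPoly 𝕜 E n) (u : E →L[𝕜] E) : HomPoly 𝕜 E n :=
  ⟨fun x => P (u x), by
    obtain ⟨A, hA⟩ := P.2
    exact ⟨A.compContinuousLinearMap fun _ => u, fun x => by simp [hA]⟩⟩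

@[simp] theorem comp_apply (P : HomPoly 𝕜 E n) (u : E →L[𝕜] E) (x : E) : P.comp u x = P (u x) := rfl

@[simp] theorem sub_apply (P Q : HomPoly 𝕜 E n) (x : E) : (P - Q) x = P x - Q x := rfl

theorem norm_comp_le (P : HomPoly 𝕜 E n) (u : E →L[𝕜] E) : ‖P.comp u‖ ≤ ‖u‖ ^ n * ‖P‖ :=
  norm_le _ fun x hx => by
    rw [comp_apply, mul_comm]
    refine (P.norm_apply_le_mul_pow _).trans (mul_le_mul_of_nonneg_left ?_ (norm_nonneg P))
    exact pow_le_pow_left₀ (norm_nonneg _) (u.unit_le_opNorm x hx) n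

end HomPoly

/-! ### Weak continuity on bounded sets -/

section WeakContinuity

variable {𝕜 E : Type*} [RCLike 𝕜] [NormedAddCommGroup E] [NormedSpace 𝕜 E]

theorem continuous_weakSpace_functional (γ : StrongDual 𝕜 E) :
    Continuous fun y : WeakSpace 𝕜 E => γ ((toWeakSpace 𝕜 E).symm y) :=
  WeakBilin.eval_continuous (topDualPairing 𝕜 E).flip γ

/-- A continuous linear map with values in a finite dimensional subspace is continuous from the weak
topology to the norm topology. -/
theorem continuous_weakSpace_of_finiteDimensional (u : E →L[𝕜] E) (F : Submodule 𝕜 E)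
    [FiniteDimensional 𝕜 F] (hu : ∀ x, u x ∈ F) :
    Continuous fun y : WeakSpace 𝕜 E => u ((toWeakSpace 𝕜 E).symm y) := by
  let b := Module.finBasis 𝕜 F
  let v : E →L[𝕜] F := u.codRestrict F hu
  let φ : Fin (Module.finrank 𝕜 F) → StrongDual 𝕜 E := fun i =>
    (LinearMap.toContinuousLinearMap (b.coord i)).comp v
  have hrep : ∀ x, u x = ∑ i, φ i x • (b i : E) := fun x => by
    have h1 := congrArg (Subtype.val : F → E) (b.sum_repr (v x))
    rw [AddSubmonoidClass.coe_finsetSum] at h1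
    exact h1.symm
  simp only [hrep]
  exact continuous_finsetSum _ fun i _ =>
    (continuous_weakSpace_functional (φ i)).smul continuous_const

theorem tendsto_weakSpace_of_forall_functional {y : ℕ → E} {x : E}
    (h : ∀ γ : StrongDual 𝕜 E, Tendsto (fun i => γ (y i)) atTop (𝓝 (γ x))) :
    Tendsto (fun i => toWeakSpace 𝕜 E (y i)) atTop (𝓝 (toWeakSpace 𝕜 E x)) := by
  have hind : Topology.IsInducing fun (x : WeakSpace 𝕜 E) (γ : StrongDual 𝕜 E) =>
    γ ((toWeakSpace 𝕜 E).symm x) := ⟨rfl⟩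
  exact hind.tendsto_nhds_iff.2 (tendsto_pi_nhds.2 h)

theorem comp_mem_weaklyContHomPoly {k : ℕ} (P : HomPoly 𝕜 E k) (u : E →L[𝕜] E)
    (F : Submodule 𝕜 E) [FiniteDimensional 𝕜 F] (hu : ∀ x, u x ∈ F) :
    P.comp u ∈ weaklyContHomPoly 𝕜 E k := fun _ _ =>
  (P.continuous.comp (continuous_weakSpace_of_finiteDimensional u F hu)).continuousOn

theorem isClosed_weaklyContHomPoly (k : ℕ) :
    IsClosed (weaklyContHomPoly 𝕜 E k : Set (HomPoly 𝕜 E k)) := by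
  refine isClosed_of_closure_subset fun P hP B hB => ?_
  obtain ⟨R, hR0, hR⟩ := hB.exists_pos_norm_le
  refine continuousOn_of_uniform_approx_of_continuousOn fun V hV => ?_
  obtain ⟨ε, hε, hεV⟩ := Metric.mem_uniformity_dist.1 hV
  -- By homogeneity, `‖P - Q‖ < ε / R ^ k` means uniform closeness within `ε` on the ball of radius
  -- `R`.
  obtain ⟨Q, hQ, hPQ⟩ := Metric.mem_closure_iff.1 hP (ε / R ^ k) (by positivity)
  refine ⟨_, hQ B hB, ?_⟩
  rintro _ ⟨x, hx, rfl⟩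
  refine hεV ?_
  rw [dist_eq_norm, LinearEquiv.symm_apply_apply, ← HomPoly.sub_apply]
  rw [dist_eq_norm, lt_div_iff₀ (by positivity)] at hPQ
  refine (HomPoly.norm_apply_le_mul_pow _ _).trans_lt (lt_of_le_of_lt ?_ hPQ)
  gcongr
  exact hR x hx

/-- Along a bounded sequence of operators tending to zero weakly, uniformly on bounded sets, the
compositions with a polynomial that is weakly continuous on bounded sets tend to zero in norm. -/
theorem tendsto_comp_zero_of_mem_weaklyContHomPoly {k : ℕ} (hk : k ≠ 0) {P : HomPoly 𝕜 E k}
    (hP : P ∈ weaklyContHomPoly 𝕜 E k) {u : ℕ → E →L[𝕜] E} {C : ℝ} (hC : ∀ i, ‖u i‖ ≤ C)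
    (hu : ∀ γ : StrongDual 𝕜 E, Tendsto (fun i => γ.comp (u i)) atTop (𝓝 0)) :
    Tendsto (fun i => P.comp (u i)) atTop (𝓝 0) := by
  -- With near-maximizers `x i`, the points `u i (x i)` are bounded and weakly null, so only weak
  -- continuity of `P` at `0` is needed.
  have hsup : ∀ i, ∃ x : E, ‖x‖ ≤ 1 ∧ ‖P.comp (u i)‖ ≤ ‖P (u i x)‖ + 1 / ((i : ℝ) + 1) := by
    intro i
    by_contra! hcon
    have h1 : ‖P.comp (u i)‖ ≤ ‖P.comp (u i)‖ - 1 / ((i : ℝ) + 1) :=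
      HomPoly.norm_le _ fun x hx => by
        have := hcon x hx
        rw [HomPoly.comp_apply]
        linarith
    have h2 : (0 : ℝ) < 1 / ((i : ℝ) + 1) := by positivity
    linarith
  choose x hx hle using hsup
  have hC0 : 0 ≤ C := (norm_nonneg _).trans (hC 0)
  have hmem : ∀ i, u i (x i) ∈ Metric.closedBall (0 : E) C := fun i => by
    rw [mem_closedBall_zero_iff]
    exact ((u i).unit_le_opNorm _ (hx i)).trans (hC i)
  have hweak : Tendsto (fun i => toWeakSpace 𝕜 E (u i (x i))) atTop (𝓝 (toWeakSpace 𝕜 E 0)) := by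
    refine tendsto_weakSpace_of_forall_functional fun γ => ?_
    rw [_root_.map_zero]
    refine squeeze_zero_norm (fun i => ?_) (tendsto_zero_iff_norm_tendsto_zero.1 (hu γ))
    exact (γ.comp (u i)).unit_le_opNorm _ (hx i)
  have hcont := hP _ (Metric.isBounded_closedBall (x := (0 : E)) (r := C)) (toWeakSpace 𝕜 E 0)
    ⟨0, by simpa using hC0, rfl⟩
  have hlim := hcont.tendsto.comp (tendsto_nhdsWithin_iff.2
    ⟨hweak, Eventually.of_forall fun i => ⟨_, hmem i, rfl⟩⟩)
  have hlim' : Tendsto (fun i => P (u i (x i))) atTop (𝓝 0) := by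
    simpa [Function.comp_def, P.map_zero hk] using hlim
  refine squeeze_zero_norm hle ?_
  simpa using hlim'.norm.add tendsto_one_div_add_atTop_nhds_zero_nat

end WeakContinuity

/-! ### Block diagonal polynomials -/

namespace FDD

variable {𝕜 E : Type*} [RCLike 𝕜] [NormedAddCommGroup E] [NormedSpace 𝕜 E] (D : FDD 𝕜 E)
  [CompleteSpace E]

/-- The truncated sequence is itself an expansion, so uniqueness applies. -/
theorem coeff_proj (N : ℕ) (x : E) (i : ℕ) :
    D.coeff (D.proj N x) i = if i < N then D.coeff x i else 0 := by
  refine (congrFun (D.eq_coeff (x := D.proj N x)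
    (a := fun i => if i < N then D.coeff x i else 0) (fun i => ?_) ?_) i).symm
  · split_ifs
    exacts [D.coeff_mem x i, (D.summand i).zero_mem]
  · refine tendsto_const_nhds.congr' ?_
    filter_upwards [eventually_ge_atTop N] with M hM
    rw [← Finset.sum_filter, D.proj_apply]
    congr 1
    ext i
    simp only [Finset.mem_range, Finset.mem_filter]
    omega

theorem proj_proj (M N : ℕ) (x : E) : D.proj M (D.proj N x) = D.proj (min M N) x := by
  rw [D.proj_apply M, D.proj_apply (min M N)]
  simp only [coeff_proj]
  rw [← Finset.sum_filter]
  congr 1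
  ext i
  simp

theorem blockProj_proj {m : ℕ → ℕ} (hm : Monotone m) (i j : ℕ) (x : E) :
    D.blockProj m i (D.proj (m j) x) = if i < j then D.blockProj m i x else 0 := by
  simp only [blockProj, _root_.sub_apply, proj_proj]
  split_ifs with hij
  · rw [min_eq_left (hm (Nat.succ_le_of_lt hij)), min_eq_left (hm hij.le)]
  · have hji : j ≤ i := not_lt.1 hij
    rw [min_eq_right (hm (hji.trans i.le_succ)), min_eq_right (hm hji), sub_self]

theorem proj_blockProj (m : ℕ → ℕ) (N i : ℕ) (x : E) :
    D.proj N (D.blockProj m i x) = D.blockProj m i (D.proj N x) := by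
  simp only [blockProj, _root_.sub_apply, _root_.map_sub, proj_proj, min_comm]

theorem exists_norm_proj_le : ∃ C : ℝ, ∀ N, ‖D.proj N‖ ≤ C :=
  banach_steinhaus D.projLinear_bounded

theorem exists_finiteDimensional_proj_mem (N : ℕ) :
    ∃ F : Submodule 𝕜 E, FiniteDimensional 𝕜 F ∧ ∀ x, D.proj N x ∈ F := by
  have := D.finiteDimensional
  refine ⟨(Finset.range N).sup D.summand, Submodule.finiteDimensional_finset_sup _ _, fun x => ?_⟩
  rw [D.proj_apply]
  exact Submodule.sum_mem _ fun i hi =>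
    (Finset.le_sup (f := D.summand) hi : D.summand i ≤ _) (D.coeff_mem x i)

variable {m : ℕ → ℕ} {k : ℕ}

theorem comp_proj_mem_blockDiagonal {P : HomPoly 𝕜 E k} (hP : P ∈ D.blockDiagonal m k) (N : ℕ) :
    P.comp (D.proj N) ∈ D.blockDiagonal m k := fun x => by
  simpa [proj_blockProj] using hP (D.proj N x)

/-- A cut at `m j` splits no block: each `σ_i x` lies wholly in one of the two pieces, and the other
contributes `P 0 = 0`. -/
theorem apply_eq_of_mem_blockDiagonal (hm : Monotone m) (hk : k ≠ 0) {P : HomPoly 𝕜 E k}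
    (hP : P ∈ D.blockDiagonal m k) (j : ℕ) (x : E) :
    P x = P (D.proj (m j) x) + P (x - D.proj (m j) x) := by
  refine tendsto_nhds_unique (hP x) (((hP _).add (hP _)).congr fun N => ?_)
  rw [← Finset.sum_add_distrib]
  refine Finset.sum_congr rfl fun i _ => ?_
  rw [_root_.map_sub, D.blockProj_proj hm]
  split_ifs <;> simp [P.map_zero hk]

/-- Composition with `π_N` as an operator on the block diagonal polynomials. -/
noncomputable def compProj (m : ℕ → ℕ) (k N : ℕ) : D.blockDiagonal m k →L[𝕜] D.blockDiagonal m k :=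
  LinearMap.mkContinuous
    { toFun := fun P => ⟨(P : HomPoly 𝕜 E k).comp (D.proj N), D.comp_proj_mem_blockDiagonal P.2 N⟩
      map_add' := fun _ _ => rfl
      map_smul' := fun _ _ => rfl }
    (‖D.proj N‖ ^ k) fun _ => HomPoly.norm_comp_le _ _

@[simp] theorem coe_compProj (N : ℕ) (P : D.blockDiagonal m k) :
    (D.compProj m k N P : HomPoly 𝕜 E k) = (P : HomPoly 𝕜 E k).comp (D.proj N) := rfl

theorem compProj_mem_blockDiagonalW (N : ℕ) (P : D.blockDiagonal m k) :
    D.compProj m k N P ∈ D.blockDiagonalW m k := by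
  obtain ⟨F, hF, hmem⟩ := D.exists_finiteDimensional_proj_mem N
  exact comp_mem_weaklyContHomPoly (P : HomPoly 𝕜 E k) (D.proj N) F hmem

theorem isClosed_blockDiagonalW (m : ℕ → ℕ) (k : ℕ) :
    IsClosed (D.blockDiagonalW m k : Set (D.blockDiagonal m k)) :=
  (isClosed_weaklyContHomPoly k).preimage continuous_subtype_val

theorem coe_sub_compProj (hm : Monotone m) (hk : k ≠ 0) (j : ℕ) (P : D.blockDiagonal m k) :
    ((P - D.compProj m k (m j) P : D.blockDiagonal m k) : HomPoly 𝕜 E k) =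
      (P : HomPoly 𝕜 E k).comp (ContinuousLinearMap.id 𝕜 E - D.proj (m j)) := by
  refine HomPoly.ext fun x => ?_
  rw [Submodule.coe_sub, coe_compProj, HomPoly.sub_apply, HomPoly.comp_apply, HomPoly.comp_apply,
    D.apply_eq_of_mem_blockDiagonal hm hk P.2 j x]
  simp

theorem tendsto_compProj (hshr : D.IsShrinking) (hm : StrictMono m) (hk : k ≠ 0)
    {P : D.blockDiagonal m k} (hP : P ∈ D.blockDiagonalW m k) :
    Tendsto (fun j => D.compProj m k (m j) P) atTop (𝓝 P) := by
  obtain ⟨C, hC⟩ := D.exists_norm_proj_le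
  have h0 : Tendsto (fun j => (P : HomPoly 𝕜 E k).comp
      (ContinuousLinearMap.id 𝕜 E - D.proj (m j))) atTop (𝓝 0) := by
    -- Shrinkingness says exactly that `γ ∘ (1 - π_{m_j})` tends to zero in norm.
    refine tendsto_comp_zero_of_mem_weaklyContHomPoly hk hP (C := 1 + C) (fun j => ?_) fun γ => ?_
    · exact (norm_sub_le _ _).trans (add_le_add ContinuousLinearMap.norm_id_le (hC _))
    · simpa [ContinuousLinearMap.comp_sub] using
        ((tendsto_const_nhds (x := γ)).sub ((hshr γ).comp hm.tendsto_atTop))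
  rw [tendsto_iff_norm_sub_tendsto_zero]
  refine (tendsto_zero_iff_norm_tendsto_zero.1 h0).congr fun j => ?_
  rw [← D.coe_sub_compProj hm.monotone hk, norm_sub_rev]
  rfl

end FDD

/-! ### The norm estimate and the conclusion -/

/-- Both `a` and `b` are at most `1 + ε`, since `1 + ε ≤ (1 + ε) ^ n`; the `k - n` surplus factors
therefore cost `(1 + ε) ^ (k - n)`. -/
theorem pow_add_pow_le_of_pow_add_pow_le {n k : ℕ} (hn : 1 ≤ n) (hk : n ≤ k) {a b ε : ℝ}
    (ha : 0 ≤ a) (hb : 0 ≤ b) (hε : 0 ≤ ε) (h : a ^ n + b ^ n ≤ 1 + ε) :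
    a ^ k + b ^ k ≤ (1 + ε) ^ (k - n + 1) := by
  have aux : ∀ t : ℝ, 0 ≤ t → t ^ n ≤ 1 + ε → t ^ k ≤ (1 + ε) ^ (k - n) * t ^ n := by
    intro t ht htn
    have h1 : t ≤ 1 + ε := le_of_pow_le_pow_left₀ (by omega : n ≠ 0) (by positivity)
      (htn.trans (le_self_pow₀ (by linarith) (by omega)))
    calc t ^ k = t ^ (k - n) * t ^ n := by rw [← pow_add, Nat.sub_add_cancel hk]
      _ ≤ (1 + ε) ^ (k - n) * t ^ n := by gcongr
  have h1 := aux a ha (by linarith [pow_nonneg hb n])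
  have h2 := aux b hb (by linarith [pow_nonneg ha n])
  calc a ^ k + b ^ k ≤ (1 + ε) ^ (k - n) * (a ^ n + b ^ n) := by linarith
    _ ≤ (1 + ε) ^ (k - n) * (1 + ε) := by gcongr
    _ = (1 + ε) ^ (k - n + 1) := (pow_succ _ _).symm

theorem FDD.norm_compProj_add_le {𝕜 E : Type*} [RCLike 𝕜] [NormedAddCommGroup E] [NormedSpace 𝕜 E]
    [CompleteSpace E] (D : FDD 𝕜 E) {m : ℕ → ℕ} (hm : Monotone m) {n k : ℕ} (hn : 1 ≤ n)
    (hk : n ≤ k) {ε : ℝ} (hε : 0 ≤ ε) {j : ℕ}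
    (h : ∀ x : E, ‖D.proj (m j) x‖ ^ n + ‖x - D.proj (m j) x‖ ^ n ≤ (1 + ε) * ‖x‖ ^ n)
    (P Q : D.blockDiagonal m k) :
    ‖D.compProj m k (m j) P + (Q - D.compProj m k (m j) Q)‖ ≤
      (1 + ε) ^ (k - n + 1) * max ‖P‖ ‖Q‖ := by
  refine HomPoly.norm_le ((D.compProj m k (m j) P + (Q - D.compProj m k (m j) Q) :
    D.blockDiagonal m k) : HomPoly 𝕜 E k) fun x hx => ?_
  rw [Submodule.coe_add, D.coe_sub_compProj hm (by omega), D.coe_compProj, HomPoly.add_apply,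
    HomPoly.comp_apply, HomPoly.comp_apply, _root_.sub_apply,
    ContinuousLinearMap.id_apply]
  have hM : 0 ≤ max ‖P‖ ‖Q‖ := le_max_of_le_left (norm_nonneg P)
  have hx' : ‖D.proj (m j) x‖ ^ n + ‖x - D.proj (m j) x‖ ^ n ≤ 1 + ε :=
    (h x).trans (mul_le_of_le_one_right (by linarith) (pow_le_one₀ (norm_nonneg x) hx))
  have hpow := pow_add_pow_le_of_pow_add_pow_le hn hk (norm_nonneg _) (norm_nonneg _) hε hx'
  have hP := (P : HomPoly 𝕜 E k).norm_apply_le_mul_pow (D.proj (m j) x)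
  have hQ := (Q : HomPoly 𝕜 E k).norm_apply_le_mul_pow (x - D.proj (m j) x)
  calc _ ≤ _ := norm_add_le _ _
    _ ≤ ‖P‖ * ‖D.proj (m j) x‖ ^ k + ‖Q‖ * ‖x - D.proj (m j) x‖ ^ k := add_le_add hP hQ
    _ ≤ max ‖P‖ ‖Q‖ * ‖D.proj (m j) x‖ ^ k + max ‖P‖ ‖Q‖ * ‖x - D.proj (m j) x‖ ^ k := by
        gcongr
        exacts [le_max_left _ _, le_max_right _ _]
    _ = max ‖P‖ ‖Q‖ * (‖D.proj (m j) x‖ ^ k + ‖x - D.proj (m j) x‖ ^ k) := (mul_add _ _ _).symm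
    _ ≤ max ‖P‖ ‖Q‖ * (1 + ε) ^ (k - n + 1) := mul_le_mul_of_nonneg_left hpow hM
    _ = _ := mul_comm _ _

theorem proposition4p2 {𝕜 E : Type*} [RCLike 𝕜] [NormedAddCommGroup E] [NormedSpace 𝕜 E]
    [CompleteSpace E] (D : FDD 𝕜 E) (hunc : D.IsUnconditional) (hshr : D.IsShrinking)
    (m : ℕ → ℕ) (hm0 : m 0 = 0) (hm : StrictMono m) (n : ℕ) (hn : 1 ≤ n)
    (h : ∀ ε : ℝ, 0 < ε → ∀ j₀ : ℕ, ∃ j > j₀, ∀ x : E,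
      ‖D.proj (m j) x‖ ^ n + ‖x - D.proj (m j) x‖ ^ n ≤ (1 + ε) * ‖x‖ ^ n)
    (k : ℕ) (hk : n ≤ k) :
    IsMIdeal (D.blockDiagonalW m k) := by
  -- Taking `ε = 1 / (i + 1)` and `j₀ = i` makes the constants tend to `1` and, through `j i > i`,
  -- the indices tend to infinity.
  choose j hj hjx using fun i : ℕ => h (1 / ((i : ℝ) + 1)) (by positivity) i
  refine IsMIdeal.of_approximation (D.isClosed_blockDiagonalW m k)
    (fun i => D.compProj m k (m (j i))) (fun i => (1 + 1 / ((i : ℝ) + 1)) ^ (k - n + 1)) ?_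
    (fun i P => D.compProj_mem_blockDiagonalW _ P) (fun P hP => ?_)
    (fun i P Q => D.norm_compProj_add_le hm.monotone hn hk (by positivity) (hjx i) P Q)
  · simpa using ((tendsto_const_nhds (x := (1 : ℝ))).add
      tendsto_one_div_add_atTop_nhds_zero_nat).pow (k - n + 1)
  · exact (D.tendsto_compProj hshr hm (by omega) hP).comp
      (tendsto_atTop_mono (fun i => (hj i).le) tendsto_id)
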